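/- Consider an M/GI/1/1 system: packets arrive according to a Poisson process of rate $\lambda>0$ (the inter-arrival times are i.i.d. $\mathrm{Exp}(\lambda)$) at a single server without waiting room, which is empty at time $0$. A packet that finds the server idle is served at once and without preemption, and a packet that finds it busy is discarded. The served packets are numbered $0,1,2,\dots$. Their service times $X_0,X_1,\dots\ge 0$ are i.i.d., independent of the arrivals, with $0<\mathbb{E}[X_0]=\frac1\mu<\infty$. Let $T_A(k)$ and $T_D(k)=T_A(k)+X_k$ be the arrival and departure instants of the served packet $k$. Let $\Delta(t)=t-\max\{T_A(n):T_D(n)\le t\}$ be the age of information at time $t$ (with $\Delta(t)=t$ before the first departure). For $k\ge1$ let $I_k=T_A(k)-T_D(k-1)$ be the idle time of the server before packet $k$ and let $\nu=1/\mathbb{E}[T_D(k)-T_D(k-1)]$ be the departure rate. For $d\ge0$ put $$g(k)=\min\{(X_{k-1}+I_k+X_k-d)^+,\;X_k+I_k\}.$$ Then for every $d\ge 0$ and $k\ge 1$: $I_k\sim\mathrm{Exp}(\lambda)$, and $X_{k-1},I_k,X_k$ are independent; $\frac1\nu=\frac1\lambda+\frac1\mu$; $g(k)$ is integrable; and the violation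 probability $\mathbb{P}(\Delta>d)=\lim_{t\to\infty}\mathbb{P}(\Delta(t)>d)$, if this limit exists, equals $\nu\,\mathbb{E}[g(k)]$. Moreover, on almost every sample path, the fraction of the time interval $[0,T]$ during which $\Delta>d$ converges to $\nu\,\mathbb{E}[g(k)]$ as $T\to\infty$. -/

import Mathlib

open MeasureTheory ProbabilityTheory Filter Topology

noncomputable section

namespace MGI11

variable {Ω : Type*}

/-- Instant of the `j`-th arrival (`j = 0, 1, 2, …`), discarded or not: `Z 0` is the time of the
first arrival and `Z (j + 1)` the time between the arrivals `j` and `j + 1`. -/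
def arrivalTime (Z : ℕ → Ω → ℝ) (j : ℕ) (ω : Ω) : ℝ :=
  ∑ i ∈ Finset.range (j + 1), Z i ω

/-- The number, among all arrivals, of the `k`-th packet that is served, in a system with one server
and no waiting room that is empty at time `0`; the service of the `k`-th served packet takes
time `X k`. The first arrival finds the server idle; after packet `k` has been taken into service,
the next packet served is the first later arrival that does not find the server busy. -/
def servedIndex (Z X : ℕ → Ω → ℝ) : ℕ → Ω → ℕ
  | 0, _ => 0
  | k + 1, ω => sInf {j : ℕ | servedIndex Z X k ω < j ∧
      arrivalTime Z (servedIndex Z X k ω) ω + X k ω ≤ arrivalTime Z j ω}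

/-- Arrival instant of (served) packet `k`. -/
def TA (Z X : ℕ → Ω → ℝ) (k : ℕ) (ω : Ω) : ℝ :=
  arrivalTime Z (servedIndex Z X k ω) ω

/-- Departure instant of packet `k`, which is served upon its arrival. -/
def TD (Z X : ℕ → Ω → ℝ) (k : ℕ) (ω : Ω) : ℝ :=
  TA Z X k ω + X k ω

/-- Age of information at time `t`: `t - max {TA n : TD n ≤ t}`. Before the first departure
the set is empty, its supremum is `0`, and the age is `t`. -/
def age (Z X : ℕ → Ω → ℝ) (t : ℝ) (ω : Ω) : ℝ :=
  t - sSup {s : ℝ | ∃ n : ℕ, TD Z X n ω ≤ t ∧ s = TA Z X n ω}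

/-- Idle time of the server just before the service of packet `k`, for `k ≥ 1`. -/
def idleTime (Z X : ℕ → Ω → ℝ) (k : ℕ) (ω : Ω) : ℝ :=
  TA Z X k ω - TD Z X (k - 1) ω

/-- `g(k) = min {(X_{k-1} + I_k + X_k - d)⁺, X_k + I_k}`, for `k ≥ 1`. -/
def g (Z X : ℕ → Ω → ℝ) (d : ℝ) (k : ℕ) (ω : Ω) : ℝ :=
  min (max (X (k - 1) ω + idleTime Z X k ω + X k ω - d) 0) (X k ω + idleTime Z X k ω)

variable [MeasurableSpace Ω]

/-- Departure rate `ν = 1 / E[TD k - TD (k - 1)]`, for `k ≥ 1`. -/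
def departureRate (P : Measure Ω) (Z X : ℕ → Ω → ℝ) (k : ℕ) : ℝ :=
  1 / ∫ ω, (TD Z X k ω - TD Z X (k - 1) ω) ∂P

/-- The data of an M/GI/1/1 system with arrival rate `lam`: inter-arrival times `Z` with law
`Exp(lam)`, identically distributed nonnegative service times `X`, and all of
`Z 0, Z 1, …, X 0, X 1, …` mutually independent. -/
structure IsSystem (P : Measure Ω) (lam : ℝ) (Z X : ℕ → Ω → ℝ) : Prop where
  measurable_Z : ∀ n, Measurable (Z n)
  measurable_X : ∀ n, Measurable (X n)
  map_Z : ∀ n, P.map (Z n) = expMeasure lam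
  identDistrib_X : ∀ n, IdentDistrib (X n) (X 0) P P
  nonneg_X : ∀ n, ∀ᵐ ω ∂P, 0 ≤ X n ω
  indep : iIndepFun (Sum.elim Z X) P

end MGI11

end

/-!
By the memoryless property, the gaps between the arrivals after a fixed time `x` (the first one
counted from `x`) are again i.i.d. exponential. Applied at the departure instants, this shows that
the idle times are i.i.d. exponential and independent of all service times. Between the departures
of packets `k - 1` and `k` the age equals `t - TA (k - 1)`, so it exceeds `d` for a time of exactly
`g k`. The variables `g k` are identically distributed, and independent as soon as their indices
differ by at least `2`; hence the strong law of large numbers holds for them, as it does for the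
lengths of the cycles, and dividing one law by the other gives the fraction of time. By Fubini's
theorem and dominated convergence this fraction is also the limit of the time averages of
`P (Δ t > d)`, hence the limit of `P (Δ t > d)` itself if there is one.
-/

namespace MGI11

section StrongLaw

lemma tendsto_succ_div_natCast {b : ℕ → ℝ} {a : ℝ}
    (hb : Tendsto (fun n : ℕ => b n / n) atTop (𝓝 a)) :
    Tendsto (fun n : ℕ => b (n + 1) / n) atTop (𝓝 a) := by
  have h := ((tendsto_add_atTop_iff_nat 1).2 hb).div (tendsto_natCast_div_add_atTop (1 : ℝ))
    one_ne_zero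
  rw [div_one] at h
  refine h.congr fun n => ?_
  rw [Pi.div_apply, Nat.cast_add_one, div_div_div_cancel_right₀ n.cast_add_one_ne_zero]

lemma tendsto_atTop_of_tendsto_div_natCast {u : ℕ → ℝ} {c : ℝ} (hc : 0 < c)
    (hu : Tendsto (fun n : ℕ => u n / n) atTop (𝓝 c)) : Tendsto u atTop atTop := by
  refine (hu.pos_mul_atTop hc tendsto_natCast_atTop_atTop).congr' ?_
  filter_upwards [eventually_ne_atTop 0] with n hn
  exact div_mul_cancel₀ _ (Nat.cast_ne_zero.2 hn)

lemma tendsto_const_add_div_natCast {b : ℕ → ℝ} {a : ℝ} (c : ℝ)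
    (hb : Tendsto (fun n : ℕ => b n / n) atTop (𝓝 a)) :
    Tendsto (fun n : ℕ => (c + b n) / n) atTop (𝓝 a) := by
  simpa only [add_div, zero_add] using (tendsto_const_div_atTop_nhds_zero_nat c).add hb

lemma tendsto_comp_div_natCast {b : ℕ → ℝ} {q : ℕ → ℕ} {a c : ℝ} (hc : 0 < c)
    (hb : Tendsto (fun n : ℕ => b n / n) atTop (𝓝 a))
    (hq : Tendsto (fun n : ℕ => (q n : ℝ) / n) atTop (𝓝 c)) :
    Tendsto (fun n : ℕ => b (q n) / n) atTop (𝓝 (a * c)) := by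
  have hqtop : Tendsto q atTop atTop :=
    tendsto_natCast_atTop_iff.1 (tendsto_atTop_of_tendsto_div_natCast hc hq)
  refine ((hb.comp hqtop).mul hq).congr' ?_
  filter_upwards [hqtop.eventually_ne_atTop 0] with n hn
  exact div_mul_div_cancel₀ (Nat.cast_ne_zero.2 hn)

lemma sum_range_eq_sum_even_add_sum_odd (u : ℕ → ℝ) (n : ℕ) :
    ∑ i ∈ Finset.range n, u i = ∑ j ∈ Finset.range ((n + 1) / 2), u (2 * j) +
      ∑ j ∈ Finset.range (n / 2), u (2 * j + 1) := by
  induction n with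
  | zero => simp
  | succ n ih =>
    rw [Finset.sum_range_succ, ih, show (n + 1 + 1) / 2 = n / 2 + 1 by omega]
    obtain ⟨m, rfl | rfl⟩ := n.even_or_odd'
    · rw [show (2 * m + 1) / 2 = m by omega, show 2 * m / 2 = m by omega, Finset.sum_range_succ]
      ring
    · rw [show (2 * m + 1 + 1) / 2 = m + 1 by omega, show (2 * m + 1) / 2 = m by omega,
        Finset.sum_range_succ (fun j => u (2 * j + 1))]
      ring

lemma tendsto_sum_div_of_even_of_odd {u : ℕ → ℝ} {a : ℝ}
    (heven : Tendsto (fun n : ℕ => (∑ j ∈ Finset.range n, u (2 * j)) / n) atTop (𝓝 a))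
    (hodd : Tendsto (fun n : ℕ => (∑ j ∈ Finset.range n, u (2 * j + 1)) / n) atTop (𝓝 a)) :
    Tendsto (fun n : ℕ => (∑ i ∈ Finset.range n, u i) / n) atTop (𝓝 a) := by
  have hhalf : Tendsto (fun n : ℕ => ((n / 2 : ℕ) : ℝ) / n) atTop (𝓝 (1 / 2)) := by
    refine ((tendsto_nat_floor_mul_div_atTop one_half_pos.le).comp
      (tendsto_natCast_atTop_atTop (R := ℝ))).congr fun n => ?_
    rw [Function.comp_apply, one_div_mul_eq_div, Nat.floor_div_ofNat, Nat.floor_natCast]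
  have hhalf_succ : Tendsto (fun n : ℕ => (((n + 1) / 2 : ℕ) : ℝ) / n) atTop (𝓝 (1 / 2)) :=
    tendsto_succ_div_natCast (b := fun n => ((n / 2 : ℕ) : ℝ)) hhalf
  have h := (tendsto_comp_div_natCast one_half_pos heven hhalf_succ).add
    (tendsto_comp_div_natCast one_half_pos hodd hhalf)
  rw [← mul_add, add_halves, mul_one] at h
  refine h.congr fun n => ?_
  rw [sum_range_eq_sum_even_add_sum_odd u n, add_div]

lemma strong_law_ae_real_of_indepFun_of_add_two_le {Ω : Type*} [MeasurableSpace Ω] {P : Measure Ω}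
    {u : ℕ → Ω → ℝ} (hint : Integrable (u 0) P) (hident : ∀ i, IdentDistrib (u i) (u 0) P P)
    (hindep : ∀ i j, i + 2 ≤ j → IndepFun (u i) (u j) P) :
    ∀ᵐ ω ∂P, Tendsto (fun n : ℕ => (∑ i ∈ Finset.range n, u i ω) / n) atTop
      (𝓝 (∫ ω, u 0 ω ∂P)) := by
  have hsub : ∀ c, ∀ᵐ ω ∂P, Tendsto (fun n : ℕ => (∑ j ∈ Finset.range n, u (2 * j + c) ω) / n)
      atTop (𝓝 (∫ ω, u 0 ω ∂P)) := fun c => by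
    have h0 := hident (2 * 0 + c)
    rw [← h0.integral_eq]
    refine strong_law_ae_real (fun j => u (2 * j + c)) (h0.integrable_iff.2 hint) ?_
      fun j => (hident _).trans h0.symm
    intro i j hij
    rcases lt_or_gt_of_ne hij with h | h
    · exact hindep _ _ (by omega)
    · exact (hindep _ _ (by omega)).symm
  filter_upwards [hsub 0, hsub 1] with ω heven hodd
  exact tendsto_sum_div_of_even_of_odd heven hodd

end StrongLaw

section RenewalReward

lemma tendsto_div_of_tendsto_div_natCast {b c : ℕ → ℝ} {a m : ℝ} (hm : m ≠ 0)
    (hb : Tendsto (fun n : ℕ => b n / n) atTop (𝓝 a))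
    (hc : Tendsto (fun n : ℕ => c n / n) atTop (𝓝 m)) :
    Tendsto (fun n => b n / c n) atTop (𝓝 (a / m)) := by
  refine (hb.div hc hm).congr' ?_
  filter_upwards [eventually_ne_atTop 0] with n hn
  exact div_div_div_cancel_right₀ (Nat.cast_ne_zero.2 hn) _ _

lemma exists_tendsto_atTop_between {D : ℕ → ℝ} (hmono : Monotone D) (hD : Tendsto D atTop atTop) :
    ∃ N : ℝ → ℕ, Tendsto N atTop atTop ∧ ∀ T, D 0 ≤ T → D (N T) ≤ T ∧ T < D (N T + 1) := by
  have hne : ∀ T, {n : ℕ | T < D (n + 1)}.Nonempty := fun T =>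
    (((tendsto_add_atTop_iff_nat 1).2 hD).eventually_gt_atTop T).exists
  have hlt : ∀ T, T < D (sInf {n : ℕ | T < D (n + 1)} + 1) := fun T => Nat.sInf_mem (hne T)
  refine ⟨fun T => sInf {n : ℕ | T < D (n + 1)}, tendsto_atTop.2 fun M => ?_,
    fun T hT => ⟨?_, hlt T⟩⟩
  · filter_upwards [eventually_ge_atTop (D M)] with T hT
    exact Nat.lt_succ_iff.1 (hmono.reflect_lt (hT.trans_lt (hlt T)))
  · beta_reduce
    rcases h : sInf {n : ℕ | T < D (n + 1)} with _ | n
    · exact hT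
    · exact not_lt.1 (Nat.notMem_of_lt_sInf (n.lt_succ_self.trans_eq h.symm))

lemma tendsto_div_of_monotone_of_tendsto_div_natCast {B : ℝ → ℝ} (hB : Monotone B)
    (hB0 : ∀ T, 0 ≤ B T) {D : ℕ → ℝ} (hD : Monotone D) {a m : ℝ} (hm : 0 < m)
    (hBD : Tendsto (fun n : ℕ => B (D n) / n) atTop (𝓝 a))
    (hDm : Tendsto (fun n : ℕ => D n / n) atTop (𝓝 m)) :
    Tendsto (fun T => B T / T) atTop (𝓝 (a / m)) := by
  have hDtop : Tendsto D atTop atTop := tendsto_atTop_of_tendsto_div_natCast hm hDm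
  obtain ⟨N, hNtop, hN⟩ := exists_tendsto_atTop_between hD hDtop
  have hlower : Tendsto (fun n => B (D n) / D (n + 1)) atTop (𝓝 (a / m)) :=
    tendsto_div_of_tendsto_div_natCast hm.ne' hBD (tendsto_succ_div_natCast hDm)
  have hupper : Tendsto (fun n => B (D (n + 1)) / D n) atTop (𝓝 (a / m)) :=
    tendsto_div_of_tendsto_div_natCast hm.ne'
      (tendsto_succ_div_natCast (b := fun n => B (D n)) hBD) hDm
  refine tendsto_of_tendsto_of_tendsto_of_le_of_le' (hlower.comp hNtop) (hupper.comp hNtop) ?_ ?_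
  · filter_upwards [eventually_ge_atTop (D 0), eventually_gt_atTop 0] with T hT hpos
    exact div_le_div₀ (hB0 T) (hB (hN T hT).1) hpos (hN T hT).2.le
  · filter_upwards [eventually_ge_atTop (D 0), hNtop.eventually (hDtop.eventually_gt_atTop 0)]
      with T hT hpos
    exact div_le_div₀ (hB0 _) (hB (hN T hT).2.le) hpos (hN T hT).1

end RenewalReward

section OccupationTime

/-- The time that a path spends, during `[0, T]`, in a state it occupies at the times in `A`. -/
noncomputable def occupationTime (A : Set ℝ) (T : ℝ) : ℝ :=
  volume.real {t | 0 ≤ t ∧ t ≤ T ∧ t ∈ A}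

variable (A : Set ℝ)

lemma occupationTime_eq_inter (T : ℝ) : occupationTime A T = volume.real (A ∩ Set.Icc 0 T) := by
  rw [occupationTime]
  congr 1
  ext t
  exact and_assoc.symm.trans and_comm

lemma occupationTime_nonneg (T : ℝ) : 0 ≤ occupationTime A T :=
  measureReal_nonneg

lemma measure_inter_Icc_ne_top (s t : ℝ) : volume (A ∩ Set.Icc s t) ≠ ⊤ :=
  measure_ne_top_of_subset Set.inter_subset_right isCompact_Icc.measure_ne_top

lemma monotone_occupationTime : Monotone (occupationTime A) := fun s t hst => by
  simp only [occupationTime_eq_inter]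
  exact measureReal_mono (Set.inter_subset_inter_right A (Set.Icc_subset_Icc_right hst))
    (measure_inter_Icc_ne_top A 0 t)

lemma occupationTime_le {T : ℝ} (hT : 0 ≤ T) : occupationTime A T ≤ T := by
  rw [occupationTime_eq_inter]
  refine (measureReal_mono Set.inter_subset_right isCompact_Icc.measure_ne_top).trans_eq ?_
  rw [Real.volume_real_Icc_of_le hT, sub_zero]

lemma occupationTime_add {s t : ℝ} (hs : 0 ≤ s) (hst : s ≤ t) :
    occupationTime A t = occupationTime A s + volume.real (A ∩ Set.Ioc s t) := by
  have hinter : A ∩ Set.Icc 0 t ∩ Set.Iic s = A ∩ Set.Icc 0 s := by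
    rw [Set.inter_assoc]
    congr 1
    ext x
    exact ⟨fun h => ⟨h.1.1, h.2⟩, fun h => ⟨⟨h.1, h.2.trans hst⟩, h.2⟩⟩
  have hdiff : (A ∩ Set.Icc 0 t) \ Set.Iic s = A ∩ Set.Ioc s t := by
    rw [Set.inter_sdiff_assoc]
    congr 1
    ext x
    exact ⟨fun h => ⟨not_le.1 h.2, h.1.2⟩, fun h => ⟨⟨hs.trans h.1.le, h.2⟩, not_le.2 h.1⟩⟩
  rw [occupationTime_eq_inter, occupationTime_eq_inter, ← hinter, ← hdiff]
  exact (measureReal_inter_add_sdiff measurableSet_Iic (measure_inter_Icc_ne_top A 0 t)).symm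

lemma occupationTime_eq_add_sum {D : ℕ → ℝ} (hD : Monotone D) (hD0 : 0 ≤ D 0) (n : ℕ) :
    occupationTime A (D n) = occupationTime A (D 0) +
      ∑ i ∈ Finset.range n, volume.real (A ∩ Set.Ioc (D i) (D (i + 1))) := by
  induction n with
  | zero => rw [Finset.range_zero, Finset.sum_empty, add_zero]
  | succ n ih =>
    rw [Finset.sum_range_succ, ← add_assoc, ← ih]
    exact occupationTime_add A (hD0.trans (hD n.zero_le)) (hD n.le_succ)

end OccupationTime

section TimeAverage

lemma tendsto_inv_smul_intervalIntegral {E : Type*} [NormedAddCommGroup E] [NormedSpace ℝ E]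
    [CompleteSpace E] {f : ℝ → E} {p : E} {C : ℝ} (hf : StronglyMeasurable f)
    (hC : ∀ t, ‖f t‖ ≤ C) (hp : Tendsto f atTop (𝓝 p)) :
    Tendsto (fun T : ℝ => T⁻¹ • ∫ t in (0 : ℝ)..T, f t) atTop (𝓝 p) := by
  have hlim : Tendsto (fun T : ℝ => ∫ s in (0 : ℝ)..1, f (T * s)) atTop
      (𝓝 (∫ _ in (0 : ℝ)..1, p)) := by
    refine intervalIntegral.tendsto_integral_filter_of_dominated_convergence (fun _ => C)
      (.of_forall fun T => (hf.comp_measurable (measurable_const_mul T)).aestronglyMeasurable)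
      (.of_forall fun T => ae_of_all _ fun s _ => hC (T * s)) intervalIntegrable_const
      (ae_of_all _ fun s hs => hp.comp (tendsto_id.atTop_mul_const ?_))
    rw [Set.uIoc_of_le zero_le_one] at hs
    exact hs.1
  rw [intervalIntegral.integral_const, sub_zero, one_smul] at hlim
  refine hlim.congr' ?_
  filter_upwards [eventually_ne_atTop 0] with T hT
  rw [intervalIntegral.integral_comp_mul_left f hT, mul_zero, mul_one]

variable {Ω : Type*} [MeasurableSpace Ω] {P : Measure Ω} [IsProbabilityMeasure P]
  {S : Set (ℝ × Ω)}

lemma occupationTime_section_eq (hS : MeasurableSet S) (T : ℝ) (ω : Ω) :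
    occupationTime ((·, ω) ⁻¹' S) T = (volume.restrict (Set.Icc 0 T)).real ((·, ω) ⁻¹' S) := by
  rw [occupationTime_eq_inter, measureReal_restrict_apply (measurable_prodMk_right hS)]

lemma measurable_occupationTime_section (hS : MeasurableSet S) (T : ℝ) :
    Measurable fun ω => occupationTime ((·, ω) ⁻¹' S) T := by
  simp only [occupationTime_section_eq hS]
  exact (measurable_measure_prodMk_right hS).ennreal_toReal

lemma integral_occupationTime_section (hS : MeasurableSet S) {T : ℝ} (hT : 0 ≤ T) :
    ∫ ω, occupationTime ((·, ω) ⁻¹' S) T ∂P = ∫ t in (0 : ℝ)..T, P.real (Prod.mk t ⁻¹' S) := by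
  rw [intervalIntegral.integral_of_le hT, ← integral_Icc_eq_integral_Ioc]
  simp only [occupationTime_section_eq hS, measureReal_def]
  rw [integral_toReal (measurable_measure_prodMk_right hS).aemeasurable
      (ae_of_all _ fun ω => measure_lt_top _ _),
    integral_toReal (measurable_measure_prodMk_left hS).aemeasurable
      (ae_of_all _ fun t => measure_lt_top _ _),
    ← Measure.prod_apply hS, ← Measure.prod_apply_symm hS]

lemma eq_of_tendsto_of_ae_tendsto_occupationTime (hS : MeasurableSet S) {p c : ℝ}
    (hp : Tendsto (fun t => P.real (Prod.mk t ⁻¹' S)) atTop (𝓝 p))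
    (hc : ∀ᵐ ω ∂P, Tendsto (fun T => occupationTime ((·, ω) ⁻¹' S) T / T) atTop (𝓝 c)) :
    p = c := by
  have haverage : Tendsto (fun T => ∫ ω, occupationTime ((·, ω) ⁻¹' S) T / T ∂P) atTop
      (𝓝 p) := by
    refine (tendsto_inv_smul_intervalIntegral (C := 1)
      (measurable_measure_prodMk_left hS).ennreal_toReal.stronglyMeasurable
      (fun t => (Real.norm_of_nonneg measureReal_nonneg).trans_le measureReal_le_one)
      hp).congr' ?_
    filter_upwards [eventually_ge_atTop 0] with T hT
    rw [integral_div, integral_occupationTime_section hS hT, smul_eq_mul, inv_mul_eq_div]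
    rfl
  have hdominated : Tendsto (fun T => ∫ ω, occupationTime ((·, ω) ⁻¹' S) T / T ∂P) atTop
      (𝓝 (∫ _, c ∂P)) := by
    refine tendsto_integral_filter_of_dominated_convergence (fun _ => 1)
      (.of_forall fun T =>
        ((measurable_occupationTime_section hS T).div_const T).aestronglyMeasurable)
      ?_ (integrable_const _) hc
    filter_upwards [eventually_ge_atTop 0] with T hT
    refine ae_of_all _ fun ω => ?_
    rw [Real.norm_of_nonneg (div_nonneg (occupationTime_nonneg _ T) hT)]
    exact div_le_one_of_le₀ (occupationTime_le _ hT) hT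
  rw [integral_const, probReal_univ, one_smul] at hdominated
  exact tendsto_nhds_unique haverage hdominated

end TimeAverage

section Exponential

variable {r : ℝ}

lemma measurable_exponentialPDF (r : ℝ) : Measurable (exponentialPDF r) :=
  (measurable_exponentialPDFReal r).ennreal_ofReal

lemma exponentialPDF_eq_mul_sub (r : ℝ) {u z : ℝ} (hu : 0 ≤ u) (hz : u ≤ z) :
    exponentialPDF r z = ENNReal.ofReal (Real.exp (-(r * u))) * exponentialPDF r (z - u) := by
  rw [exponentialPDF_of_nonneg (hu.trans hz), exponentialPDF_of_nonneg (sub_nonneg.2 hz),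
    ← ENNReal.ofReal_mul (Real.exp_pos _).le, mul_left_comm, ← Real.exp_add]
  ring_nf

lemma map_sub_restrict_Ici_expMeasure (r : ℝ) {u : ℝ} (hu : 0 ≤ u) :
    ((expMeasure r).restrict (Set.Ici u)).map (fun z => z - u) =
      ENNReal.ofReal (Real.exp (-(r * u))) • expMeasure r := by
  have hsub : Measurable fun z : ℝ => z - u := measurable_id.sub_const u
  ext A hA
  have hAu : MeasurableSet ((fun z => z - u) ⁻¹' A) := hsub hA
  rw [Measure.map_apply hsub hA, Measure.restrict_apply hAu,
    Measure.smul_apply, smul_eq_mul]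
  change volume.withDensity (exponentialPDF r) _ = _ * volume.withDensity (exponentialPDF r) _
  rw [withDensity_apply _ (hAu.inter measurableSet_Ici), withDensity_apply _ hA,
    ← lintegral_indicator (hAu.inter measurableSet_Ici), ← lintegral_indicator hA,
    ← lintegral_const_mul _ ((measurable_exponentialPDF r).indicator hA),
    ← lintegral_sub_right_eq_self (fun w => ENNReal.ofReal (Real.exp (-(r * u))) *
      A.indicator (exponentialPDF r) w) u]
  refine lintegral_congr fun z => ?_
  by_cases hzA : z - u ∈ A
  · rw [Set.indicator_of_mem hzA]
    by_cases hz : u ≤ z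
    · rw [Set.indicator_of_mem (show z ∈ _ ∩ Set.Ici u from ⟨hzA, hz⟩),
        exponentialPDF_eq_mul_sub r hu hz]
    · rw [Set.indicator_of_notMem fun h => hz h.2, exponentialPDF_of_neg (by linarith), mul_zero]
  · rw [Set.indicator_of_notMem fun h => hzA h.1, Set.indicator_of_notMem hzA, mul_zero]

lemma ae_nonneg_expMeasure (r : ℝ) : ∀ᵐ z ∂expMeasure r, 0 ≤ z := by
  change ∀ᵐ z ∂volume.withDensity (exponentialPDF r), 0 ≤ z
  rw [ae_withDensity_iff (measurable_exponentialPDF r)]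
  refine ae_of_all _ fun z hz => ?_
  by_contra! hneg
  exact hz (exponentialPDF_of_neg hneg)

lemma exponentialPDF_mul_ofReal (hr : 0 < r) (z : ℝ) :
    exponentialPDF r z * ENNReal.ofReal z = ENNReal.ofReal (1 / r) * gammaPDF 2 r z := by
  rcases lt_or_ge z 0 with hz | hz
  · rw [exponentialPDF_of_neg hz, gammaPDF_of_neg hz, zero_mul, mul_zero]
  · rw [exponentialPDF_of_nonneg hz, gammaPDF_of_nonneg hz, ← ENNReal.ofReal_mul (by positivity),
      ← ENNReal.ofReal_mul (by positivity), show (2 : ℝ) - 1 = 1 by norm_num, Real.Gamma_two,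
      Real.rpow_one, Real.rpow_two]
    congr 1
    field_simp

lemma lintegral_ofReal_expMeasure (hr : 0 < r) :
    ∫⁻ z, ENNReal.ofReal z ∂expMeasure r = ENNReal.ofReal (1 / r) := by
  change ∫⁻ z, ENNReal.ofReal z ∂volume.withDensity (exponentialPDF r) = _
  rw [lintegral_withDensity_eq_lintegral_mul _ (measurable_exponentialPDF r)
    ENNReal.measurable_ofReal]
  simp only [Pi.mul_apply, exponentialPDF_mul_ofReal hr]
  rw [lintegral_const_mul (f := gammaPDF 2 r) _ (measurable_gammaPDFReal 2 r).ennreal_ofReal,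
    lintegral_gammaPDF_eq_one two_pos hr, mul_one]

lemma integrable_id_expMeasure (hr : 0 < r) : Integrable (fun z => z) (expMeasure r) := by
  refine ⟨measurable_id.aestronglyMeasurable, ?_⟩
  rw [hasFiniteIntegral_iff_ofReal (ae_nonneg_expMeasure r)]
  exact (lintegral_ofReal_expMeasure hr).trans_lt ENNReal.ofReal_lt_top

lemma integral_id_expMeasure (hr : 0 < r) : ∫ z, z ∂expMeasure r = 1 / r := by
  rw [integral_eq_lintegral_of_nonneg_ae (ae_nonneg_expMeasure r)
    measurable_id.aestronglyMeasurable, lintegral_ofReal_expMeasure hr,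
    ENNReal.toReal_ofReal (by positivity)]

end Exponential

section Sequences

variable {α β : Type*}

lemma measurable_sInf_setOf [MeasurableSpace α] {p : ℕ → α → Prop}
    (hp : ∀ n, MeasurableSet {a | p n a}) : Measurable fun a => sInf {n | p n a} := by
  classical
  have hex : MeasurableSet {a | ∃ n, p n a} := by
    simpa only [Set.ofPred_exists] using MeasurableSet.iUnion hp
  have heq : (fun a => sInf {n | p n a}) =
      fun a => if h : ∃ n, p n a then Nat.find h else 0 := by
    funext a
    split_ifs with h
    · exact Nat.sInf_def h
    · exact Nat.sInf_eq_zero.2 (.inr (Set.eq_empty_of_forall_notMem fun n hn => h ⟨n, hn⟩))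
  rw [heq]
  refine Measurable.dite (s := {a | ∃ n, p n a})
    (f := fun a => Nat.find a.2) (g := fun _ => 0) ?_ measurable_const hex
  exact measurable_find (p := fun (a : {a | ∃ n, p n a}) n => p n a) (fun a => a.2)
    fun n => measurable_subtype_coe (hp n)

lemma measurable_apply_nat [MeasurableSpace α] [MeasurableSpace β] {f : ℕ → α → β} {N : α → ℕ}
    (hf : ∀ n, Measurable (f n)) (hN : Measurable N) : Measurable fun a => f (N a) a :=
  (measurable_from_prod_countable_right (f := fun p : ℕ × α => f p.1 p.2) hf).comp
    (hN.prodMk measurable_id)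

lemma tsum_measure_eq_and_mem [MeasurableSpace α] (μ : Measure α) {N : α → ℕ} (hN : Measurable N)
    (s : Set α) : ∑' n, μ {a | N a = n ∧ a ∈ s} = μ s := by
  have hfiber : ∀ n, MeasurableSet (N ⁻¹' {n}) := fun n => hN (measurableSet_singleton n)
  have h := tsum_measure_preimage_singleton (μ := μ.restrict s) Set.countable_univ
    fun n _ => hfiber n
  rw [tsum_univ fun n => μ.restrict s (N ⁻¹' {n}), Set.preimage_univ,
    Measure.restrict_apply_univ] at h
  rw [← h]
  exact tsum_congr fun n => (Measure.restrict_apply (hfiber n)).symm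

/-- The sequence `a, z 0, z 1, …`, used to condition a random sequence on its first term. -/
def consSeq (a : α) (z : ℕ → α) : ℕ → α
  | 0 => a
  | n + 1 => z n

lemma sum_range_succ_consSeq [AddCommMonoid α] (a : α) (z : ℕ → α) (m : ℕ) :
    ∑ i ∈ Finset.range (m + 1), consSeq a z i = a + ∑ i ∈ Finset.range m, z i := by
  rw [Finset.sum_range_succ', add_comm]
  rfl

lemma preimage_consSeq_pi_range (t : ℕ → Set α) (n : ℕ) :
    (fun p : α × (ℕ → α) => consSeq p.1 p.2) ⁻¹' Set.pi (Finset.range (n + 1)) t =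
      t 0 ×ˢ Set.pi (Finset.range n) fun i => t (i + 1) := by
  ext ⟨a, z⟩
  simp only [Set.mem_preimage, Set.mem_pi, Finset.mem_coe, Finset.mem_range, Set.mem_prod]
  refine ⟨fun h => ⟨h 0 n.succ_pos, fun i hi => h (i + 1) (Nat.succ_lt_succ hi)⟩, ?_⟩
  rintro ⟨h0, h⟩ (_ | i) hi
  · exact h0
  · exact h i (Nat.lt_of_succ_lt_succ hi)

variable [MeasurableSpace α]

lemma measurable_consSeq : Measurable fun p : α × (ℕ → α) => consSeq p.1 p.2 := by
  refine measurable_pi_lambda _ fun n => ?_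
  cases n with
  | zero => exact measurable_fst
  | succ n => exact (measurable_pi_apply n).comp measurable_snd

lemma measurableSet_head_tail {A : Set α} (hA : MeasurableSet A) {B : Set (ℕ → α)}
    (hB : MeasurableSet B) : MeasurableSet {z : ℕ → α | z 0 ∈ A ∧ (fun i => z (i + 1)) ∈ B} :=
  (measurable_pi_apply 0 hA).inter
    (measurable_pi_lambda _ (fun i => measurable_pi_apply (i + 1)) hB)

lemma measurableSet_pi_range {t : ℕ → Set α} (ht : ∀ i, MeasurableSet (t i)) (n : ℕ) :
    MeasurableSet (Set.pi (Finset.range n) t) :=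
  .pi (Finset.countable_toSet _) fun i _ => ht i

lemma eq_infinitePi_of_pi_range {μ : ℕ → Measure α} [∀ i, IsProbabilityMeasure (μ i)]
    {ν : Measure (ℕ → α)}
    (h : ∀ (n : ℕ) (t : ℕ → Set α), (∀ i, MeasurableSet (t i)) →
      ν (Set.pi (Finset.range n) t) = ∏ i ∈ Finset.range n, μ i (t i)) :
    ν = Measure.infinitePi μ := by
  classical
  refine Measure.eq_infinitePi _ fun s t ht => ?_
  obtain ⟨n, hn⟩ := s.exists_nat_subset_range
  have hpi : Set.pi s t = Set.pi (Finset.range n) (s.piecewise t fun _ => Set.univ) := by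
    ext z
    refine ⟨fun hz i _ => ?_, fun hz i hi => ?_⟩
    · by_cases hi : i ∈ s
      · simpa only [Finset.piecewise_eq_of_mem _ _ _ hi] using hz i hi
      · simp only [Finset.piecewise_eq_of_notMem _ _ _ hi, Set.mem_univ]
    · simpa only [Finset.piecewise_eq_of_mem _ _ _ hi] using hz i (hn hi)
  have hmeas : ∀ i, MeasurableSet (s.piecewise t (fun _ => Set.univ) i) := fun i => by
    by_cases hi : i ∈ s <;> simp [hi, ht]
  rw [hpi, h n _ hmeas, ← Finset.prod_subset hn fun i _ hi => by simp [hi]]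
  exact Finset.prod_congr rfl fun i hi => by rw [Finset.piecewise_eq_of_mem _ _ _ hi]

lemma measurePreserving_consSeq (μ : ℕ → Measure α) [∀ i, IsProbabilityMeasure (μ i)] :
    MeasurePreserving (fun p : α × (ℕ → α) => consSeq p.1 p.2)
      ((μ 0).prod (Measure.infinitePi fun i => μ (i + 1))) (Measure.infinitePi μ) := by
  refine ⟨measurable_consSeq, eq_infinitePi_of_pi_range fun n t ht => ?_⟩
  rw [Measure.map_apply measurable_consSeq (measurableSet_pi_range ht n)]
  cases n with
  | zero => simp
  | succ n =>
    rw [preimage_consSeq_pi_range, Measure.prod_prod,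
      Measure.infinitePi_pi _ fun i _ => ht (i + 1), Finset.prod_range_succ', mul_comm]

end Sequences

section Crossing

/-- The first index at which the partial sums of `z` reach the level `x`: if `z` is a sequence of
gaps between arrivals, this is the number of arrivals before time `x`. -/
noncomputable def crossing (x : ℝ) (z : ℕ → ℝ) : ℕ :=
  sInf {m : ℕ | x ≤ ∑ i ∈ Finset.range (m + 1), z i}

/-- The gaps between arrivals, as seen by an observer who starts at time `x`: the waiting time from
`x` to the next arrival, followed by the gaps after that arrival. -/
noncomputable def gapsAfter (x : ℝ) (z : ℕ → ℝ) : ℕ → ℝ :=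
  consSeq (∑ i ∈ Finset.range (crossing x z + 1), z i - x) fun i => z (crossing x z + 1 + i)

lemma measurable_crossing {α : Type*} [MeasurableSpace α] {x : α → ℝ} {z : α → ℕ → ℝ}
    (hx : Measurable x) (hz : Measurable z) : Measurable fun a => crossing (x a) (z a) :=
  measurable_sInf_setOf fun _ => measurableSet_le hx (by fun_prop)

lemma measurable_gapsAfter {α : Type*} [MeasurableSpace α] {x : α → ℝ} {z : α → ℕ → ℝ}
    (hx : Measurable x) (hz : Measurable z) : Measurable fun a => gapsAfter (x a) (z a) := by
  have hsum : Measurable fun a => ∑ i ∈ Finset.range (crossing (x a) (z a) + 1), z a i :=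
    measurable_apply_nat (f := fun m a => ∑ i ∈ Finset.range (m + 1), z a i)
      (fun _ => by fun_prop) (measurable_crossing hx hz)
  have htail : Measurable fun a i => z a (crossing (x a) (z a) + 1 + i) :=
    measurable_pi_lambda _ fun i =>
      measurable_apply_nat (f := fun m a => z a (m + 1 + i))
        (fun _ => by fun_prop) (measurable_crossing hx hz)
  exact measurable_consSeq.comp ((hsum.sub hx).prodMk htail)

variable {x a : ℝ} {z : ℕ → ℝ}

lemma crossing_consSeq_of_le (h : x ≤ a) (z : ℕ → ℝ) : crossing x (consSeq a z) = 0 :=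
  Nat.sInf_eq_zero.2 (.inl (by simpa [sum_range_succ_consSeq] using h))

lemma gapsAfter_consSeq_of_le (h : x ≤ a) (z : ℕ → ℝ) :
    gapsAfter x (consSeq a z) = consSeq (a - x) z := by
  rw [gapsAfter, crossing_consSeq_of_le h, sum_range_succ_consSeq, Finset.sum_range_zero, add_zero]
  congr 1
  funext i
  rw [zero_add, add_comm]
  rfl

lemma exists_le_sum_range_succ (hz : Tendsto (fun n => ∑ i ∈ Finset.range n, z i) atTop atTop)
    (x : ℝ) : ∃ m, x ≤ ∑ i ∈ Finset.range (m + 1), z i :=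
  (((tendsto_add_atTop_iff_nat 1).2 hz).eventually_ge_atTop x).exists

lemma crossing_consSeq_of_lt (h : a < x)
    (hz : Tendsto (fun n => ∑ i ∈ Finset.range n, z i) atTop atTop) :
    crossing x (consSeq a z) = crossing (x - a) z + 1 := by
  have hiff : ∀ m, x ≤ ∑ i ∈ Finset.range (m + 1 + 1), consSeq a z i ↔
      x - a ≤ ∑ i ∈ Finset.range (m + 1), z i := fun m => by
    rw [sum_range_succ_consSeq, sub_le_iff_le_add']
  have hpos : 1 ≤ crossing x (consSeq a z) := by
    obtain ⟨m, hm⟩ := exists_le_sum_range_succ hz (x - a)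
    refine le_csInf ⟨m + 1, (hiff m).2 hm⟩ ?_
    rintro (_ | m) hm
    · exact absurd hm (by simpa [sum_range_succ_consSeq] using h)
    · exact Nat.succ_pos m
  rw [crossing, ← Nat.sInf_add hpos]
  simp only [hiff]
  rfl

lemma gapsAfter_consSeq_of_lt (h : a < x)
    (hz : Tendsto (fun n => ∑ i ∈ Finset.range n, z i) atTop atTop) :
    gapsAfter x (consSeq a z) = gapsAfter (x - a) z := by
  rw [gapsAfter, gapsAfter, crossing_consSeq_of_lt h hz, sum_range_succ_consSeq]
  congr 1
  · ring
  · funext i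
    rw [add_right_comm _ 1 i]
    rfl

end Crossing

section Renewal

/-- The law of a sequence of independent `Exp(r)` random variables. -/
noncomputable def expSeq (r : ℝ) : Measure (ℕ → ℝ) :=
  Measure.infinitePi fun _ => expMeasure r

variable {r : ℝ}

lemma isProbabilityMeasure_expSeq (hr : 0 < r) : IsProbabilityMeasure (expSeq r) := by
  have := isProbabilityMeasure_expMeasure hr
  unfold expSeq
  infer_instance

lemma measurePreserving_eval_expSeq (hr : 0 < r) (i : ℕ) :
    MeasurePreserving (fun z => z i) (expSeq r) (expMeasure r) :=
  have := isProbabilityMeasure_expMeasure hr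
  measurePreserving_eval_infinitePi (fun _ => expMeasure r) i

lemma measurePreserving_consSeq_expSeq (hr : 0 < r) :
    MeasurePreserving (fun p : ℝ × (ℕ → ℝ) => consSeq p.1 p.2)
      ((expMeasure r).prod (expSeq r)) (expSeq r) :=
  have := isProbabilityMeasure_expMeasure hr
  measurePreserving_consSeq fun _ => expMeasure r

lemma expSeq_eq_lintegral (hr : 0 < r) {E : Set (ℕ → ℝ)} (hE : MeasurableSet E) :
    expSeq r E = ∫⁻ a, expSeq r {z | consSeq a z ∈ E} ∂expMeasure r := by
  have := isProbabilityMeasure_expSeq hr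
  rw [← (measurePreserving_consSeq_expSeq hr).measure_preimage hE.nullMeasurableSet,
    Measure.prod_apply (measurable_consSeq hE)]
  rfl

lemma expSeq_head_tail (hr : 0 < r) {A : Set ℝ} (hA : MeasurableSet A) {B : Set (ℕ → ℝ)}
    (hB : MeasurableSet B) :
    expSeq r {z | z 0 ∈ A ∧ (fun i => z (i + 1)) ∈ B} = expMeasure r A * expSeq r B := by
  have := isProbabilityMeasure_expSeq hr
  rw [← (measurePreserving_consSeq_expSeq hr).measure_preimage
      (measurableSet_head_tail hA hB).nullMeasurableSet,
    ← Measure.prod_prod]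
  rfl

lemma ae_expSeq_tendsto_sum (hr : 0 < r) :
    ∀ᵐ z ∂expSeq r, Tendsto (fun n => ∑ i ∈ Finset.range n, z i) atTop atTop := by
  have := isProbabilityMeasure_expMeasure hr
  have heval := measurePreserving_eval_expSeq hr
  have hident : ∀ i, IdentDistrib (fun z : ℕ → ℝ => z i) (fun z => z 0) (expSeq r) (expSeq r) :=
    fun i => ⟨(heval i).aemeasurable, (heval 0).aemeasurable,
      (heval i).map_eq.trans (heval 0).map_eq.symm⟩
  have hindep : iIndepFun (fun (i : ℕ) (z : ℕ → ℝ) => z i) (expSeq r) :=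
    iIndepFun_infinitePi (P := fun _ : ℕ => expMeasure r) fun _ => measurable_id
  have hint : Integrable (fun z : ℕ → ℝ => z 0) (expSeq r) :=
    (heval 0).integrable_comp_of_integrable (integrable_id_expMeasure hr)
  have hmean : ∫ z, z 0 ∂expSeq r = 1 / r := by
    rw [← integral_id_expMeasure hr, ← (heval 0).map_eq]
    exact (integral_map (heval 0).aemeasurable measurable_id.aestronglyMeasurable).symm
  filter_upwards [strong_law_ae_real _ hint (fun i j hij => hindep.indepFun hij) hident] with z hz
  exact tendsto_atTop_of_tendsto_div_natCast (hmean ▸ one_div_pos.2 hr) hz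

lemma measurableSet_crossing_gapsAfter {C : Set (ℕ → ℝ)} (hC : MeasurableSet C) (x : ℝ) (m : ℕ) :
    MeasurableSet {z | crossing x z = m ∧ gapsAfter x z ∈ C} :=
  (measurable_crossing measurable_const measurable_id (measurableSet_singleton m)).inter
    (measurable_gapsAfter measurable_const measurable_id hC)

lemma expSeq_crossing_zero_gapsAfter (hr : 0 < r) {x : ℝ} (hx : 0 ≤ x) {C : Set (ℕ → ℝ)}
    (hC : MeasurableSet C) :
    expSeq r {z | crossing x z = 0 ∧ gapsAfter x z ∈ C} =
      ENNReal.ofReal (Real.exp (-(r * x))) * expSeq r C := by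
  have := isProbabilityMeasure_expSeq hr
  have hsection : ∀ a, expSeq r {z | crossing x (consSeq a z) = 0 ∧ gapsAfter x (consSeq a z) ∈ C} =
      (Set.Ici x).indicator (fun a => expSeq r {z | consSeq (a - x) z ∈ C}) a := by
    intro a
    rcases le_or_gt x a with h | h
    · simp [Set.indicator_of_mem (Set.mem_Ici.2 h), crossing_consSeq_of_le h,
        gapsAfter_consSeq_of_le h]
    · rw [Set.indicator_of_notMem (by simpa using h), measure_eq_zero_iff_ae_notMem]
      filter_upwards [ae_expSeq_tendsto_sum hr] with z hz
      simp [crossing_consSeq_of_lt h hz]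
  have hmeas : Measurable fun b => expSeq r {z | consSeq b z ∈ C} :=
    measurable_measure_prodMk_left (measurable_consSeq hC)
  refine (expSeq_eq_lintegral hr (measurableSet_crossing_gapsAfter hC x 0)).trans ?_
  refine (lintegral_congr hsection).trans ?_
  rw [lintegral_indicator measurableSet_Ici,
    ← lintegral_map (f := fun b => expSeq r {z | consSeq b z ∈ C}) hmeas
      (measurable_sub_const x), map_sub_restrict_Ici_expMeasure r hx,
    lintegral_smul_measure, ← expSeq_eq_lintegral hr hC, smul_eq_mul]

lemma expSeq_crossing_succ_gapsAfter (hr : 0 < r) (x : ℝ) {C : Set (ℕ → ℝ)}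
    (hC : MeasurableSet C) (m : ℕ) :
    expSeq r {z | crossing x z = m + 1 ∧ gapsAfter x z ∈ C} =
      ∫⁻ a in Set.Iio x,
        expSeq r {z | crossing (x - a) z = m ∧ gapsAfter (x - a) z ∈ C} ∂expMeasure r := by
  rw [expSeq_eq_lintegral hr (measurableSet_crossing_gapsAfter hC x (m + 1)),
    ← lintegral_indicator measurableSet_Iio]
  refine lintegral_congr fun a => ?_
  rcases lt_or_ge a x with h | h
  · rw [Set.indicator_of_mem (Set.mem_Iio.2 h)]
    refine measure_congr ?_
    filter_upwards [ae_expSeq_tendsto_sum hr] with z hz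
    refine propext ?_
    change (_ ∧ _) ↔ (_ ∧ _)
    rw [crossing_consSeq_of_lt h hz, gapsAfter_consSeq_of_lt h hz, Nat.add_right_cancel_iff]
  · simp [h, crossing_consSeq_of_le h]

lemma expSeq_crossing_gapsAfter (hr : 0 < r) {C : Set (ℕ → ℝ)} (hC : MeasurableSet C) (m : ℕ)
    {x : ℝ} (hx : 0 ≤ x) :
    expSeq r {z | crossing x z = m ∧ gapsAfter x z ∈ C} =
      expSeq r {z | crossing x z = m} * expSeq r C := by
  have := isProbabilityMeasure_expSeq hr
  have huniv : ∀ (n : ℕ) (y : ℝ), expSeq r {z | crossing y z = n} =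
      expSeq r {z | crossing y z = n ∧ gapsAfter y z ∈ Set.univ} := fun n y =>
    congrArg _ (by simp only [Set.mem_univ, and_true])
  induction m generalizing x with
  | zero =>
    rw [huniv 0 x, expSeq_crossing_zero_gapsAfter hr hx hC,
      expSeq_crossing_zero_gapsAfter hr hx .univ, measure_univ, mul_one]
  | succ m ih =>
    rw [huniv (m + 1) x, expSeq_crossing_succ_gapsAfter hr x hC,
      expSeq_crossing_succ_gapsAfter hr x .univ, ← lintegral_mul_const' _ _ (measure_ne_top _ _)]
    refine setLIntegral_congr_fun measurableSet_Iio fun a ha => ?_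
    rw [← huniv m (x - a)]
    exact ih (sub_nonneg.2 (le_of_lt ha))

lemma measurePreserving_gapsAfter (hr : 0 < r) {x : ℝ} (hx : 0 ≤ x) :
    MeasurePreserving (gapsAfter x) (expSeq r) (expSeq r) := by
  have := isProbabilityMeasure_expSeq hr
  have hcross : Measurable (crossing x) := measurable_crossing measurable_const measurable_id
  have hgaps : Measurable (gapsAfter x) := measurable_gapsAfter measurable_const measurable_id
  refine ⟨hgaps, ?_⟩
  ext C hC
  rw [Measure.map_apply hgaps hC]
  calc expSeq r (gapsAfter x ⁻¹' C)
      = ∑' m, expSeq r {z | crossing x z = m ∧ gapsAfter x z ∈ C} :=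
        (tsum_measure_eq_and_mem _ hcross _).symm
    _ = ∑' m, expSeq r {z | crossing x z = m ∧ z ∈ Set.univ} * expSeq r C :=
        tsum_congr fun m => by
          simpa only [Set.mem_univ, and_true] using expSeq_crossing_gapsAfter hr hC m hx
    _ = expSeq r C := by
        rw [ENNReal.tsum_mul_right, tsum_measure_eq_and_mem _ hcross, measure_univ, one_mul]

end Renewal

section IdleTimes

/-- The gaps between the arrivals that are left after `k` service times `x 0, …, x (k - 1)`, each
followed by the wait for the next arrival, when the gaps are `z` at the start of service `0`. -/
noncomputable def residual (x z : ℕ → ℝ) : ℕ → ℕ → ℝ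
  | 0 => z
  | k + 1 => fun i => gapsAfter (x k) (residual x z k) (i + 1)

/-- The successive idle times of a server with service times `x`, when the gaps between the arrivals
after the start of service `0` are `z`. -/
noncomputable def idleSeq (x z : ℕ → ℝ) (k : ℕ) : ℝ :=
  gapsAfter (x k) (residual x z k) 0

lemma measurable_gapsAfter_residual (k : ℕ) :
    Measurable fun p : (ℕ → ℝ) × (ℕ → ℝ) => gapsAfter (p.1 k) (residual p.1 p.2 k) := by
  induction k with
  | zero => exact measurable_gapsAfter (by fun_prop) measurable_snd
  | succ k ih =>
    exact measurable_gapsAfter (by fun_prop)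
      (measurable_pi_lambda _ fun i => (measurable_pi_apply (i + 1)).comp ih)

lemma measurable_idleSeq : Measurable fun p : (ℕ → ℝ) × (ℕ → ℝ) => idleSeq p.1 p.2 :=
  measurable_pi_lambda _ fun k => (measurable_pi_apply 0).comp (measurable_gapsAfter_residual k)

lemma residual_succ_eq (x z : ℕ → ℝ) (k : ℕ) :
    residual x z (k + 1) =
      residual (fun i => x (i + 1)) (fun i => gapsAfter (x 0) z (i + 1)) k := by
  induction k with
  | zero => rfl
  | succ k ih => rw [residual, ih, residual]

lemma idleSeq_succ_eq (x z : ℕ → ℝ) (k : ℕ) :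
    idleSeq x z (k + 1) =
      idleSeq (fun i => x (i + 1)) (fun i => gapsAfter (x 0) z (i + 1)) k := by
  rw [idleSeq, residual_succ_eq, idleSeq]

lemma idleSeq_mem_pi_range_succ (x z : ℕ → ℝ) (t : ℕ → Set ℝ) (n : ℕ) :
    idleSeq x z ∈ Set.pi (Finset.range (n + 1)) t ↔
      gapsAfter (x 0) z 0 ∈ t 0 ∧
        idleSeq (fun i => x (i + 1)) (fun i => gapsAfter (x 0) z (i + 1)) ∈
          Set.pi (Finset.range n) fun i => t (i + 1) := by
  simp only [Set.mem_pi, Finset.mem_coe, Finset.mem_range, ← idleSeq_succ_eq]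
  refine ⟨fun h => ⟨h 0 n.succ_pos, fun i hi => h (i + 1) (Nat.succ_lt_succ hi)⟩, ?_⟩
  rintro ⟨h0, h⟩ (_ | i) hi
  · exact h0
  · exact h i (Nat.lt_of_succ_lt_succ hi)

lemma expSeq_idleSeq_mem_pi_range {r : ℝ} (hr : 0 < r) {x : ℕ → ℝ} (hx : ∀ i, 0 ≤ x i)
    {t : ℕ → Set ℝ} (ht : ∀ i, MeasurableSet (t i)) (n : ℕ) :
    expSeq r {z | idleSeq x z ∈ Set.pi (Finset.range n) t} =
      ∏ i ∈ Finset.range n, expMeasure r (t i) := by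
  have := isProbabilityMeasure_expSeq hr
  induction n generalizing x t with
  | zero => simp
  | succ n ih =>
    have htail : MeasurableSet (idleSeq (fun i => x (i + 1)) ⁻¹'
        Set.pi (Finset.range n) fun i => t (i + 1)) :=
      measurable_idleSeq.of_uncurry_left (measurableSet_pi_range (fun i => ht (i + 1)) n)
    have hbox := measurableSet_head_tail (ht 0) htail
    simp only [idleSeq_mem_pi_range_succ]
    refine ((measurePreserving_gapsAfter hr (hx 0)).measure_preimage
      hbox.nullMeasurableSet).trans ?_
    refine (expSeq_head_tail hr (ht 0) htail).trans ?_
    rw [Finset.prod_range_succ', mul_comm]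
    exact congrArg (· * _) (ih (fun i => hx (i + 1)) fun i => ht (i + 1))

lemma measurePreserving_idleSeq {r : ℝ} (hr : 0 < r) {x : ℕ → ℝ} (hx : ∀ i, 0 ≤ x i) :
    MeasurePreserving (idleSeq x) (expSeq r) (expSeq r) := by
  have := isProbabilityMeasure_expMeasure hr
  refine ⟨measurable_idleSeq.of_uncurry_left, eq_infinitePi_of_pi_range fun n t ht => ?_⟩
  rw [Measure.map_apply (measurable_idleSeq.of_uncurry_left) (measurableSet_pi_range ht n)]
  exact expSeq_idleSeq_mem_pi_range hr hx ht n

end IdleTimes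

section Paths

variable {Ω : Type*} {Z X : ℕ → Ω → ℝ} {ω : Ω}

/-- A sample path with nonnegative data along which the arrivals do not accumulate. -/
structure IsRegularPath (Z X : ℕ → Ω → ℝ) (ω : Ω) : Prop where
  nonneg_Z : 0 ≤ Z 0 ω
  nonneg_X : ∀ n, 0 ≤ X n ω
  tendsto_arrivalTime : Tendsto (fun j => arrivalTime Z j ω) atTop atTop

lemma arrivalTime_add (Z : ℕ → Ω → ℝ) (j m : ℕ) (ω : Ω) :
    arrivalTime Z (j + 1 + m) ω =
      arrivalTime Z j ω + ∑ i ∈ Finset.range (m + 1), Z (j + 1 + i) ω := by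
  rw [arrivalTime, add_assoc, Finset.sum_range_add]
  rfl

lemma TD_sub_TD (Z X : ℕ → Ω → ℝ) (n : ℕ) (ω : Ω) :
    TD Z X (n + 1) ω - TD Z X n ω = idleTime Z X (n + 1) ω + X (n + 1) ω := by
  rw [idleTime, Nat.add_sub_cancel, TD]
  ring

lemma g_succ (Z X : ℕ → Ω → ℝ) (d : ℝ) (n : ℕ) (ω : Ω) :
    g Z X d (n + 1) ω =
      min (max (TD Z X (n + 1) ω - (TA Z X n ω + d)) 0) (TD Z X (n + 1) ω - TD Z X n ω) := by
  rw [g, Nat.add_sub_cancel, TD_sub_TD, add_comm (X (n + 1) ω)]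
  congr 2
  rw [add_assoc, ← TD_sub_TD, TD, TD]
  ring

namespace IsRegularPath

lemma nonempty_setOf_served (h : IsRegularPath Z X ω) (k : ℕ) :
    {j : ℕ | servedIndex Z X k ω < j ∧
      arrivalTime Z (servedIndex Z X k ω) ω + X k ω ≤ arrivalTime Z j ω}.Nonempty :=
  ((eventually_gt_atTop _).and (h.tendsto_arrivalTime.eventually_ge_atTop _)).exists

lemma servedIndex_succ (h : IsRegularPath Z X ω) (k : ℕ) :
    servedIndex Z X (k + 1) ω = servedIndex Z X k ω + 1 +
      crossing (X k ω) (fun i => Z (servedIndex Z X k ω + 1 + i) ω) := by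
  have hiff : ∀ m, (servedIndex Z X k ω < m + (servedIndex Z X k ω + 1) ∧
      arrivalTime Z (servedIndex Z X k ω) ω + X k ω ≤
        arrivalTime Z (m + (servedIndex Z X k ω + 1)) ω) ↔
      X k ω ≤ ∑ i ∈ Finset.range (m + 1), Z (servedIndex Z X k ω + 1 + i) ω := fun m => by
    rw [add_comm m, arrivalTime_add, add_le_add_iff_left]
    exact and_iff_right (by omega)
  have hlt : servedIndex Z X k ω + 1 ≤ sInf {j | servedIndex Z X k ω < j ∧
      arrivalTime Z (servedIndex Z X k ω) ω + X k ω ≤ arrivalTime Z j ω} :=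
    (Nat.sInf_mem (h.nonempty_setOf_served k)).1
  rw [servedIndex, ← Nat.sInf_add hlt, add_comm]
  simp only [hiff]
  rfl

lemma residual_eq (h : IsRegularPath Z X ω) (k : ℕ) :
    residual (fun i => X i ω) (fun i => Z (i + 1) ω) k =
      fun i => Z (servedIndex Z X k ω + 1 + i) ω := by
  induction k with
  | zero =>
    funext i
    rw [residual, servedIndex, zero_add, add_comm]
  | succ k ih =>
    funext i
    rw [residual, ih, h.servedIndex_succ k, add_right_comm _ 1 (crossing _ _),
      add_right_comm _ (crossing _ _) 1]
    simp only [gapsAfter, consSeq, add_assoc]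

lemma idleTime_succ (h : IsRegularPath Z X ω) (k : ℕ) :
    idleTime Z X (k + 1) ω = idleSeq (fun i => X i ω) (fun i => Z (i + 1) ω) k := by
  rw [idleSeq, h.residual_eq, gapsAfter, consSeq, idleTime, TA, h.servedIndex_succ,
    arrivalTime_add, Nat.add_sub_cancel, TD, TA]
  ring

lemma TA_le_TD (h : IsRegularPath Z X ω) (n : ℕ) : TA Z X n ω ≤ TD Z X n ω :=
  le_add_of_nonneg_right (h.nonneg_X n)

lemma TD_le_TA_succ (h : IsRegularPath Z X ω) (n : ℕ) : TD Z X n ω ≤ TA Z X (n + 1) ω :=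
  (Nat.sInf_mem (h.nonempty_setOf_served n)).2

lemma monotone_TA (h : IsRegularPath Z X ω) : Monotone fun n => TA Z X n ω :=
  monotone_nat_of_le_succ fun n => (h.TA_le_TD n).trans (h.TD_le_TA_succ n)

lemma monotone_TD (h : IsRegularPath Z X ω) : Monotone fun n => TD Z X n ω :=
  monotone_nat_of_le_succ fun n => (h.TD_le_TA_succ n).trans (h.TA_le_TD (n + 1))

lemma TA_nonneg (h : IsRegularPath Z X ω) (n : ℕ) : 0 ≤ TA Z X n ω := by
  refine le_trans ?_ (h.monotone_TA n.zero_le)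
  simpa only [TA, servedIndex, arrivalTime, zero_add, Finset.sum_range_one] using h.nonneg_Z

lemma age_eq_sub_iSup (h : IsRegularPath Z X ω) (t : ℝ) :
    age Z X t ω = t - ⨆ n, if TD Z X n ω ≤ t then TA Z X n ω else 0 := by
  set S := {s : ℝ | ∃ n : ℕ, TD Z X n ω ≤ t ∧ s = TA Z X n ω}
  have hterm_nonneg : ∀ n, 0 ≤ if TD Z X n ω ≤ t then TA Z X n ω else 0 := fun n => by
    split_ifs
    exacts [h.TA_nonneg n, le_rfl]
  have hterm_le : ∀ n, (if TD Z X n ω ≤ t then TA Z X n ω else 0) ≤ max t 0 := fun n => by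
    split_ifs with hn
    exacts [((h.TA_le_TD n).trans hn).trans (le_max_left t 0), le_max_right t 0]
  have hbdd : BddAbove S := ⟨t, by rintro s ⟨n, hn, rfl⟩; exact (h.TA_le_TD n).trans hn⟩
  have hS : 0 ≤ sSup S := Real.sSup_nonneg (by rintro s ⟨n, -, rfl⟩; exact h.TA_nonneg n)
  rw [age]
  congr 1
  refine le_antisymm (Real.sSup_le ?_ (Real.iSup_nonneg hterm_nonneg)) (Real.iSup_le ?_ hS)
  · rintro s ⟨n, hn, rfl⟩
    exact (if_pos hn).ge.trans (le_ciSup ⟨max t 0, Set.forall_mem_range.2 hterm_le⟩ n)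
  · intro n
    split_ifs with hn
    exacts [le_csSup hbdd ⟨n, hn, rfl⟩, hS]

lemma age_eq_sub_TA (h : IsRegularPath Z X ω) {n : ℕ} {t : ℝ} (h1 : TD Z X n ω ≤ t)
    (h2 : t < TD Z X (n + 1) ω) : age Z X t ω = t - TA Z X n ω := by
  have hmax : IsGreatest {s : ℝ | ∃ n : ℕ, TD Z X n ω ≤ t ∧ s = TA Z X n ω} (TA Z X n ω) := by
    refine ⟨⟨n, h1, rfl⟩, ?_⟩
    rintro s ⟨m, hm, rfl⟩
    exact h.monotone_TA (Nat.lt_succ_iff.1 (h.monotone_TD.reflect_lt (hm.trans_lt h2)))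
  rw [age, hmax.csSup_eq]

lemma volume_real_age_gt_inter_Ioc (h : IsRegularPath Z X ω) (d : ℝ) (n : ℕ) :
    volume.real ({t | d < age Z X t ω} ∩ Set.Ioc (TD Z X n ω) (TD Z X (n + 1) ω)) =
      g Z X d (n + 1) ω := by
  have hae : ({t | d < age Z X t ω} ∩ Set.Ioc (TD Z X n ω) (TD Z X (n + 1) ω) : Set ℝ) =ᵐ[volume]
      Set.Ioo (max (TD Z X n ω) (TA Z X n ω + d)) (TD Z X (n + 1) ω) := by
    filter_upwards [compl_mem_ae_iff.2 (measure_singleton (μ := volume) (TD Z X (n + 1) ω))]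
      with t ht
    refine propext ?_
    change (d < age Z X t ω ∧ TD Z X n ω < t ∧ t ≤ TD Z X (n + 1) ω) ↔
      (max (TD Z X n ω) (TA Z X n ω + d) < t ∧ t < TD Z X (n + 1) ω)
    rw [max_lt_iff, and_assoc, and_left_comm]
    refine and_congr_right fun h1 => ?_
    rw [le_iff_lt_or_eq, or_iff_left (show ¬ t = TD Z X (n + 1) ω from ht)]
    refine and_congr_left fun h2 => ?_
    rw [h.age_eq_sub_TA h1.le h2, lt_sub_iff_add_lt']
  rw [measureReal_congr hae, Real.volume_real_Ioo, g_succ, ← min_sub_sub_left,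
    max_min_distrib_right, max_eq_left (sub_nonneg.2 (h.monotone_TD n.le_succ)), min_comm]

end IsRegularPath

end Paths

section Measurability

variable {Ω : Type*} [MeasurableSpace Ω] {Z X : ℕ → Ω → ℝ}

lemma measurable_arrivalTime (hZ : ∀ n, Measurable (Z n)) (j : ℕ) :
    Measurable (arrivalTime Z j) :=
  Finset.measurable_fun_sum _ fun i _ => hZ i

lemma measurable_servedIndex (hZ : ∀ n, Measurable (Z n)) (hX : ∀ n, Measurable (X n)) (k : ℕ) :
    Measurable (servedIndex Z X k) := by
  induction k with
  | zero => exact measurable_const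
  | succ k ih =>
    refine measurable_sInf_setOf fun j => (measurableSet_lt ih measurable_const).inter ?_
    exact measurableSet_le ((measurable_apply_nat (measurable_arrivalTime hZ) ih).add (hX k))
      (measurable_arrivalTime hZ j)

lemma measurable_TA (hZ : ∀ n, Measurable (Z n)) (hX : ∀ n, Measurable (X n)) (k : ℕ) :
    Measurable (TA Z X k) :=
  measurable_apply_nat (f := arrivalTime Z) (measurable_arrivalTime hZ)
    (measurable_servedIndex hZ hX k)

lemma measurable_TD (hZ : ∀ n, Measurable (Z n)) (hX : ∀ n, Measurable (X n)) (k : ℕ) :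
    Measurable (TD Z X k) :=
  (measurable_TA hZ hX k).add (hX k)

lemma measurable_idleTime (hZ : ∀ n, Measurable (Z n)) (hX : ∀ n, Measurable (X n)) (k : ℕ) :
    Measurable (idleTime Z X k) :=
  (measurable_TA hZ hX k).sub (measurable_TD hZ hX (k - 1))

end Measurability

section Independence

variable {Ω ι κ β : Type*} [MeasurableSpace Ω] [MeasurableSpace β] {P : Measure Ω}
  {U : ι → Ω → β} {V : κ → Ω → β}

lemma iIndepFun_sumElim (hU : iIndepFun U P) (hV : iIndepFun V P)
    (hUV : IndepFun (fun ω i => U i ω) (fun ω j => V j ω) P) :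
    iIndepFun (Sum.elim U V) P := by
  rw [iIndepFun_iff_measure_inter_preimage_eq_mul]
  intro S sets hS
  have hL : ∀ i ∈ S.toLeft, MeasurableSet (sets (Sum.inl i)) :=
    fun i hi => hS _ (Finset.mem_toLeft.1 hi)
  have hR : ∀ j ∈ S.toRight, MeasurableSet (sets (Sum.inr j)) :=
    fun j hj => hS _ (Finset.mem_toRight.1 hj)
  have hLR := hUV.measure_inter_preimage_eq_mul _ _
    (Finset.measurableSet_biInter _ fun i hi => measurable_pi_apply i (hL i hi))
    (Finset.measurableSet_biInter _ fun j hj => measurable_pi_apply j (hR j hj))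
  simp only [Set.preimage_iInter₂] at hLR
  rw [← Finset.toLeft_disjSum_toRight (u := S), Finset.prod_disjSum]
  refine Eq.trans (congrArg P ?_) (hLR.trans (congrArg₂ _
    (hU.measure_inter_preimage_eq_mul S.toLeft hL)
    (hV.measure_inter_preimage_eq_mul S.toRight hR)))
  ext ω
  simp [Set.mem_iInter]

lemma indepFun_process_of_sumElim (hU : ∀ i, Measurable (U i)) (hV : ∀ j, Measurable (V j))
    (h : iIndepFun (Sum.elim U V) P) : IndepFun (fun ω i => U i ω) (fun ω j => V j ω) P := by
  have hle : ∀ s, MeasurableSpace.comap (Sum.elim U V s) inferInstance ≤ ‹MeasurableSpace Ω› := by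
    rintro (i | j)
    exacts [(hU i).comap_le, (hV j).comap_le]
  have hdisj : Disjoint (Set.range (Sum.inl : ι → ι ⊕ κ)) (Set.range Sum.inr) :=
    Set.isCompl_range_inl_range_inr.disjoint
  refine indep_of_indep_of_le_left (indep_of_indep_of_le_right
    (indep_iSup_of_disjoint hle h hdisj) ?_) ?_
  · refine measurable_iff_comap_le.1 (@measurable_pi_lambda _ _ _ (_) _ _ fun j => ?_)
    exact measurable_iff_comap_le.2 (le_iSup₂_of_le (Sum.inr j) ⟨j, rfl⟩ le_rfl)
  · refine measurable_iff_comap_le.1 (@measurable_pi_lambda _ _ _ (_) _ _ fun i => ?_)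
    exact measurable_iff_comap_le.2 (le_iSup₂_of_le (Sum.inl i) ⟨i, rfl⟩ le_rfl)

end Independence

namespace IsSystem

variable {Ω : Type*} [MeasurableSpace Ω] {P : Measure Ω} {lam : ℝ} {Z X : ℕ → Ω → ℝ}

lemma map_Z_succ (h : IsSystem P lam Z X) : P.map (fun ω i => Z (i + 1) ω) = expSeq lam := by
  have hindep : iIndepFun (fun i => Z (i + 1)) P :=
    h.indep.precomp (g := fun i => Sum.inl (i + 1)) fun i j hij => by simpa using hij
  rw [hindep.map_fun_eq_infinitePi_map fun i => h.measurable_Z (i + 1)]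
  simp only [h.map_Z]
  rfl

lemma ae_isRegularPath (h : IsSystem P lam Z X) (hlam : 0 < lam) :
    ∀ᵐ ω ∂P, IsRegularPath Z X ω := by
  have hZ : ∀ᵐ ω ∂P, 0 ≤ Z 0 ω :=
    ae_of_ae_map (h.measurable_Z 0).aemeasurable (h.map_Z 0 ▸ ae_nonneg_expMeasure lam)
  have hsum : ∀ᵐ ω ∂P, Tendsto (fun n => ∑ i ∈ Finset.range n, Z (i + 1) ω) atTop atTop :=
    ae_of_ae_map (measurable_pi_lambda _ fun i => h.measurable_Z (i + 1)).aemeasurable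
      (h.map_Z_succ ▸ ae_expSeq_tendsto_sum hlam)
  filter_upwards [hZ, hsum, ae_all_iff.2 h.nonneg_X] with ω hZω hsumω hXω
  refine ⟨hZω, hXω, (tendsto_atTop_add_const_right _ (Z 0 ω) hsumω).congr fun n => ?_⟩
  rw [arrivalTime, Finset.sum_range_succ']

lemma exists_measurable_forall_age_eq (h : IsSystem P lam Z X) (hlam : 0 < lam) :
    ∃ a : ℝ × Ω → ℝ, Measurable a ∧ ∀ᵐ ω ∂P, ∀ t, age Z X t ω = a (t, ω) := by
  refine ⟨fun q => q.1 - ⨆ n, if TD Z X n q.2 ≤ q.1 then TA Z X n q.2 else 0, ?_,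
    (h.ae_isRegularPath hlam).mono fun ω hω => hω.age_eq_sub_iSup⟩
  refine measurable_fst.sub (.iSup fun n => .ite ?_ ?_ measurable_const)
  · exact measurableSet_le ((measurable_TD h.measurable_Z h.measurable_X n).comp measurable_snd)
      measurable_fst
  · exact (measurable_TA h.measurable_Z h.measurable_X n).comp measurable_snd

lemma indepFun_X_Z_succ (h : IsSystem P lam Z X) :
    IndepFun (fun ω i => X i ω) (fun ω i => Z (i + 1) ω) P := by
  refine indepFun_process_of_sumElim h.measurable_X (fun i => h.measurable_Z (i + 1)) ?_
  have hinj : Function.Injective (Sum.elim Sum.inr fun i => Sum.inl (i + 1) : ℕ ⊕ ℕ → ℕ ⊕ ℕ) :=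
    Sum.inr_injective.sumElim (Sum.inl_injective.comp (add_left_injective 1)) fun _ _ => nofun
  convert h.indep.precomp hinj using 1
  funext s
  rcases s with i | i <;> rfl

variable [IsProbabilityMeasure P]

lemma measurePreserving_X_Z_succ (h : IsSystem P lam Z X) :
    MeasurePreserving (fun ω => (fun i => X i ω, fun i => Z (i + 1) ω)) P
      ((P.map fun ω i => X i ω).prod (expSeq lam)) := by
  have hX : Measurable fun ω i => X i ω := measurable_pi_lambda _ h.measurable_X
  have hZ : Measurable fun ω i => Z (i + 1) ω :=
    measurable_pi_lambda _ fun i => h.measurable_Z (i + 1)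
  refine ⟨hX.prodMk hZ, ?_⟩
  rw [← h.map_Z_succ]
  exact (indepFun_iff_map_prod_eq_prod_map_map hX.aemeasurable hZ.aemeasurable).1
    h.indepFun_X_Z_succ

lemma measurePreserving_X_idleTime (h : IsSystem P lam Z X) (hlam : 0 < lam) :
    MeasurePreserving (fun ω => (fun i => X i ω, fun k => idleTime Z X (k + 1) ω)) P
      ((P.map fun ω i => X i ω).prod (expSeq lam)) := by
  have := isProbabilityMeasure_expSeq hlam
  have hX : Measurable fun ω i => X i ω := measurable_pi_lambda _ h.measurable_X
  have := Measure.isProbabilityMeasure_map (μ := P) hX.aemeasurable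
  have hnonneg : ∀ᵐ x ∂P.map fun ω i => X i ω, ∀ i, 0 ≤ x i :=
    ae_all_iff.2 fun i => (ae_map_iff hX.aemeasurable
      (measurableSet_le measurable_const (measurable_pi_apply i))).2 (h.nonneg_X i)
  -- Given the service times `x`, the map `idleSeq x` preserves the law of the later gaps.
  have hskew := (MeasurePreserving.id (P.map fun ω i => X i ω)).skew_product (g := idleSeq)
    measurable_idleSeq (hnonneg.mono fun x hx => (measurePreserving_idleSeq hlam hx).map_eq)
  refine ⟨hX.prodMk (measurable_pi_lambda _ fun k =>
    measurable_idleTime h.measurable_Z h.measurable_X (k + 1)), ?_⟩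
  rw [← (hskew.comp h.measurePreserving_X_Z_succ).map_eq]
  refine Measure.map_congr ?_
  filter_upwards [h.ae_isRegularPath hlam] with ω hω
  exact Prod.ext rfl (funext hω.idleTime_succ)

lemma map_idleTime_process (h : IsSystem P lam Z X) (hlam : 0 < lam) :
    P.map (fun ω k => idleTime Z X (k + 1) ω) = expSeq lam := by
  have := isProbabilityMeasure_expSeq hlam
  have hX : Measurable fun ω i => X i ω := measurable_pi_lambda _ h.measurable_X
  have := Measure.isProbabilityMeasure_map (μ := P) hX.aemeasurable
  exact (measurePreserving_snd.comp (h.measurePreserving_X_idleTime hlam)).map_eq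

lemma map_idleTime (h : IsSystem P lam Z X) (hlam : 0 < lam) (k : ℕ) :
    P.map (idleTime Z X (k + 1)) = expMeasure lam := by
  rw [← (measurePreserving_eval_expSeq hlam k).map_eq, ← h.map_idleTime_process hlam,
    Measure.map_map (measurable_pi_apply k) (measurable_pi_lambda _ fun k =>
      measurable_idleTime h.measurable_Z h.measurable_X (k + 1))]
  rfl

lemma iIndepFun_X_idleTime (h : IsSystem P lam Z X) (hlam : 0 < lam) :
    iIndepFun (Sum.elim X fun k => idleTime Z X (k + 1)) P := by
  have hI : ∀ k, Measurable (idleTime Z X (k + 1)) :=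
    fun k => measurable_idleTime h.measurable_Z h.measurable_X (k + 1)
  refine iIndepFun_sumElim (h.indep.precomp (g := Sum.inr) Sum.inr_injective) ?_ ?_
  · rw [iIndepFun_iff_map_fun_eq_infinitePi_map hI, h.map_idleTime_process hlam]
    simp only [h.map_idleTime hlam]
    rfl
  · rw [indepFun_iff_map_prod_eq_prod_map_map (measurable_pi_lambda _ h.measurable_X).aemeasurable
      (measurable_pi_lambda _ hI).aemeasurable, h.map_idleTime_process hlam]
    exact (h.measurePreserving_X_idleTime hlam).map_eq

end IsSystem

section Cycle

/-- The service times `X k` and `X (k + 1)` and the idle time between them: the part of a sample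
path that determines the age of information between the departures of packets `k` and `k + 1`. -/
noncomputable def cycle {Ω : Type*} (Z X : ℕ → Ω → ℝ) (k : ℕ) (ω : Ω) : Fin 3 → ℝ :=
  ![X k ω, idleTime Z X (k + 1) ω, X (k + 1) ω]

/-- The time during a cycle for which the age exceeds `d`, as a function of the cycle. -/
noncomputable def ageExcess (d : ℝ) (v : Fin 3 → ℝ) : ℝ :=
  min (max (v 0 + v 1 + v 2 - d) 0) (v 2 + v 1)

lemma measurable_ageExcess (d : ℝ) : Measurable (ageExcess d) := by
  unfold ageExcess
  fun_prop

namespace IsSystem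

variable {Ω : Type*} [MeasurableSpace Ω] {P : Measure Ω} {lam : ℝ} {Z X : ℕ → Ω → ℝ}

lemma measurable_cycle (h : IsSystem P lam Z X) (k : ℕ) : Measurable (cycle Z X k) := by
  refine measurable_pi_lambda _ fun i => ?_
  fin_cases i
  exacts [h.measurable_X k, measurable_idleTime h.measurable_Z h.measurable_X (k + 1),
    h.measurable_X (k + 1)]

variable [IsProbabilityMeasure P]

lemma iIndepFun_cycle (h : IsSystem P lam Z X) (hlam : 0 < lam) (k : ℕ) :
    iIndepFun ![X k, idleTime Z X (k + 1), X (k + 1)] P := by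
  have hinj : Function.Injective (![Sum.inl k, Sum.inr k, Sum.inl (k + 1)] : Fin 3 → ℕ ⊕ ℕ) := by
    intro i j hij
    fin_cases i <;> fin_cases j <;> simp at hij ⊢
  convert (h.iIndepFun_X_idleTime hlam).precomp hinj using 1
  funext i
  fin_cases i <;> rfl

lemma identDistrib_cycle (h : IsSystem P lam Z X) (hlam : 0 < lam) (k l : ℕ) :
    IdentDistrib (cycle Z X k) (cycle Z X l) P P := by
  have hX : ∀ i j, IdentDistrib (X i) (X j) P P := fun i j =>
    (h.identDistrib_X i).trans (h.identDistrib_X j).symm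
  have hI : IdentDistrib (idleTime Z X (k + 1)) (idleTime Z X (l + 1)) P P :=
    ⟨(measurable_idleTime h.measurable_Z h.measurable_X _).aemeasurable,
      (measurable_idleTime h.measurable_Z h.measurable_X _).aemeasurable,
      (h.map_idleTime hlam k).trans (h.map_idleTime hlam l).symm⟩
  convert IdentDistrib.pi (fun i => ?_) (h.iIndepFun_cycle hlam k) (h.iIndepFun_cycle hlam l)
    using 1
  · funext ω i
    fin_cases i <;> rfl
  · funext ω i
    fin_cases i <;> rfl
  · fin_cases i
    exacts [hX k l, hI, hX (k + 1) (l + 1)]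

lemma indepFun_cycle (h : IsSystem P lam Z X) (hlam : 0 < lam) {k l : ℕ} (hkl : k + 2 ≤ l) :
    IndepFun (cycle Z X k) (cycle Z X l) P := by
  let S : ℕ → Finset (ℕ ⊕ ℕ) := fun k => {Sum.inl k, Sum.inr k, Sum.inl (k + 1)}
  let φ : ∀ k, (S k → ℝ) → Fin 3 → ℝ := fun k x =>
    ![x ⟨Sum.inl k, by simp [S]⟩, x ⟨Sum.inr k, by simp [S]⟩, x ⟨Sum.inl (k + 1), by simp [S]⟩]
  have hφ : ∀ k, Measurable (φ k) := fun k => measurable_pi_lambda _ fun i => by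
    fin_cases i <;> exact measurable_pi_apply _
  have hdisj : Disjoint (S k) (S l) := by
    rw [Finset.disjoint_left]
    intro a ha hb
    simp only [S, Finset.mem_insert, Finset.mem_singleton] at ha hb
    rcases ha with rfl | rfl | rfl <;> simp at hb <;> omega
  have hmeas : ∀ s, Measurable (Sum.elim X (fun k => idleTime Z X (k + 1)) s) := by
    rintro (i | i)
    exacts [h.measurable_X i, measurable_idleTime h.measurable_Z h.measurable_X _]
  exact ((h.iIndepFun_X_idleTime hlam).indepFun_finset _ _ hdisj hmeas).comp (hφ k) (hφ l)

lemma ae_tendsto_sum_cycle_div (h : IsSystem P lam Z X) (hlam : 0 < lam) {φ : (Fin 3 → ℝ) → ℝ}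
    (hφ : Measurable φ) {k : ℕ} (hint : Integrable (fun ω => φ (cycle Z X k ω)) P) :
    ∀ᵐ ω ∂P, Tendsto (fun n : ℕ => (∑ i ∈ Finset.range n, φ (cycle Z X i ω)) / n) atTop
      (𝓝 (∫ ω, φ (cycle Z X k ω) ∂P)) := by
  have hident : ∀ i j, IdentDistrib (fun ω => φ (cycle Z X i ω)) (fun ω => φ (cycle Z X j ω)) P P :=
    fun i j => (h.identDistrib_cycle hlam i j).comp hφ
  rw [← (hident 0 k).integral_eq]
  exact strong_law_ae_real_of_indepFun_of_add_two_le (u := fun i ω => φ (cycle Z X i ω))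
    ((hident 0 k).integrable_iff.2 hint) (fun i => hident i 0)
    fun i j hij => (h.indepFun_cycle hlam hij).comp hφ hφ

end IsSystem

end Cycle

namespace IsSystem

variable {Ω : Type*} [MeasurableSpace Ω] {P : Measure Ω} {lam : ℝ} {Z X : ℕ → Ω → ℝ}

lemma integrable_X (h : IsSystem P lam Z X) (hX : Integrable (X 0) P) (k : ℕ) :
    Integrable (X k) P :=
  (h.identDistrib_X k).integrable_iff.2 hX

variable [IsProbabilityMeasure P]

lemma integrable_idleTime (h : IsSystem P lam Z X) (hlam : 0 < lam) (k : ℕ) :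
    Integrable (idleTime Z X (k + 1)) P :=
  (h.map_idleTime hlam k ▸ integrable_id_expMeasure hlam :
    Integrable (fun y => y) (P.map (idleTime Z X (k + 1)))).comp_measurable
      (measurable_idleTime h.measurable_Z h.measurable_X (k + 1))

lemma integral_idleTime (h : IsSystem P lam Z X) (hlam : 0 < lam) (k : ℕ) :
    ∫ ω, idleTime Z X (k + 1) ω ∂P = 1 / lam := by
  rw [← integral_id_expMeasure hlam, ← h.map_idleTime hlam k]
  exact (integral_map (measurable_idleTime h.measurable_Z h.measurable_X (k + 1)).aemeasurable
    aestronglyMeasurable_id).symm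

lemma integrable_TD_sub_TD (h : IsSystem P lam Z X) (hlam : 0 < lam) (hX : Integrable (X 0) P)
    (k : ℕ) : Integrable (fun ω => TD Z X (k + 1) ω - TD Z X k ω) P := by
  simp only [TD_sub_TD]
  exact (h.integrable_idleTime hlam k).add (h.integrable_X hX (k + 1))

lemma integral_TD_sub_TD (h : IsSystem P lam Z X) (hlam : 0 < lam) (hX : Integrable (X 0) P)
    (k : ℕ) : ∫ ω, (TD Z X (k + 1) ω - TD Z X k ω) ∂P = 1 / lam + ∫ ω, X 0 ω ∂P := by
  simp only [TD_sub_TD]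
  rw [integral_add (h.integrable_idleTime hlam k) (h.integrable_X hX (k + 1)),
    h.integral_idleTime hlam, (h.identDistrib_X (k + 1)).integral_eq]

lemma integral_TD_sub_TD_pos (h : IsSystem P lam Z X) (hlam : 0 < lam) (hX : Integrable (X 0) P)
    (k : ℕ) : 0 < ∫ ω, (TD Z X (k + 1) ω - TD Z X k ω) ∂P := by
  rw [h.integral_TD_sub_TD hlam hX]
  exact add_pos_of_pos_of_nonneg (one_div_pos.2 hlam) (integral_nonneg_of_ae (h.nonneg_X 0))

lemma integrable_g (h : IsSystem P lam Z X) (hlam : 0 < lam) (hX : Integrable (X 0) P)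
    (d : ℝ) (k : ℕ) : Integrable (g Z X d (k + 1)) P := by
  have hmeas : Measurable (g Z X d (k + 1)) := (measurable_ageExcess d).comp (h.measurable_cycle k)
  refine (h.integrable_TD_sub_TD hlam hX k).mono' hmeas.aestronglyMeasurable ?_
  filter_upwards [h.ae_isRegularPath hlam] with ω hω
  rw [g_succ, Real.norm_of_nonneg]
  · exact min_le_right _ _
  · exact le_min (le_max_right _ _) (sub_nonneg.2 (hω.monotone_TD k.le_succ))

lemma ae_tendsto_TD_div (h : IsSystem P lam Z X) (hlam : 0 < lam) (hX : Integrable (X 0) P)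
    (k : ℕ) : ∀ᵐ ω ∂P, Tendsto (fun n : ℕ => TD Z X n ω / n) atTop
      (𝓝 (∫ ω, (TD Z X (k + 1) ω - TD Z X k ω) ∂P)) := by
  have hint := h.integrable_TD_sub_TD hlam hX k
  simp only [TD_sub_TD] at hint ⊢
  filter_upwards [h.ae_tendsto_sum_cycle_div hlam (φ := fun v => v 1 + v 2) (by fun_prop) hint]
    with ω hω
  refine (tendsto_const_add_div_natCast (TD Z X 0 ω) hω).congr fun n => ?_
  rw [← add_sub_cancel (TD Z X 0 ω) (TD Z X n ω), ← Finset.sum_range_sub fun i => TD Z X i ω]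
  simp only [TD_sub_TD]
  rfl

lemma ae_tendsto_occupationTime_TD_div (h : IsSystem P lam Z X) (hlam : 0 < lam)
    (hX : Integrable (X 0) P) (d : ℝ) (k : ℕ) :
    ∀ᵐ ω ∂P, Tendsto (fun n : ℕ => occupationTime {t | d < age Z X t ω} (TD Z X n ω) / n) atTop
      (𝓝 (∫ ω, g Z X d (k + 1) ω ∂P)) := by
  filter_upwards [h.ae_tendsto_sum_cycle_div hlam (measurable_ageExcess d)
    (h.integrable_g hlam hX d k), h.ae_isRegularPath hlam] with ω hω hreg
  have h0 : 0 ≤ TD Z X 0 ω := (hreg.TA_nonneg 0).trans (hreg.TA_le_TD 0)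
  refine (tendsto_const_add_div_natCast (occupationTime {t | d < age Z X t ω} (TD Z X 0 ω))
    hω).congr fun n => ?_
  rw [occupationTime_eq_add_sum _ hreg.monotone_TD h0 n]
  simp only [hreg.volume_real_age_gt_inter_Ioc]
  rfl

lemma ae_tendsto_occupationTime_div (h : IsSystem P lam Z X) (hlam : 0 < lam)
    (hX : Integrable (X 0) P) (d : ℝ) (k : ℕ) :
    ∀ᵐ ω ∂P, Tendsto (fun T => occupationTime {t | d < age Z X t ω} T / T) atTop
      (𝓝 (departureRate P Z X (k + 1) * ∫ ω, g Z X d (k + 1) ω ∂P)) := by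
  filter_upwards [h.ae_tendsto_occupationTime_TD_div hlam hX d k, h.ae_tendsto_TD_div hlam hX k,
    h.ae_isRegularPath hlam] with ω hocc hTD hreg
  rw [departureRate, one_div_mul_eq_div]
  exact tendsto_div_of_monotone_of_tendsto_div_natCast (monotone_occupationTime _)
    (occupationTime_nonneg _) hreg.monotone_TD (h.integral_TD_sub_TD_pos hlam hX k) hocc hTD

lemma eq_of_tendsto_age_of_ae_tendsto_occupationTime (h : IsSystem P lam Z X) (hlam : 0 < lam)
    {d p c : ℝ} (hp : Tendsto (fun t => P.real {ω | d < age Z X t ω}) atTop (𝓝 p))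
    (hc : ∀ᵐ ω ∂P, Tendsto (fun T => occupationTime {t | d < age Z X t ω} T / T) atTop (𝓝 c)) :
    p = c := by
  obtain ⟨a, ha, hage⟩ := h.exists_measurable_forall_age_eq hlam
  refine eq_of_tendsto_of_ae_tendsto_occupationTime (P := P) (S := {q | d < a q})
    (measurableSet_lt measurable_const ha) (hp.congr fun t => measureReal_congr ?_) ?_
  · filter_upwards [hage] with ω hω
    exact congrArg (d < ·) (hω t)
  · filter_upwards [hage, hc] with ω hω hcω
    simp only [hω] at hcω
    exact hcω

end IsSystem

end MGI11

theorem theorem6 {Ω : Type*} [MeasurableSpace Ω] (P : Measure Ω) [IsProbabilityMeasure P]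
    (lam mu : ℝ) (hlam : 0 < lam) (hmu : 0 < mu) (Z X : ℕ → Ω → ℝ)
    (hsys : MGI11.IsSystem P lam Z X)
    (hXint : Integrable (X 0) P) (hXmean : ∫ ω, X 0 ω ∂P = 1 / mu)
    (d : ℝ) (hd : 0 ≤ d) (k : ℕ) (hk : 1 ≤ k) :
    -- the idle time is exponential, and independent of the two service times in `g(k)`
    P.map (MGI11.idleTime Z X k) = expMeasure lam ∧
    iIndepFun ![X (k - 1), MGI11.idleTime Z X k, X k] P ∧
    -- the departure rate
    1 / MGI11.departureRate P Z X k = 1 / lam + 1 / mu ∧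
    -- the violation probability, if it exists
    Integrable (MGI11.g Z X d k) P ∧
    (∀ p : ℝ, Tendsto (fun t : ℝ => P.real {ω | d < MGI11.age Z X t ω}) atTop (𝓝 p) →
      p = MGI11.departureRate P Z X k * ∫ ω, MGI11.g Z X d k ω ∂P) ∧
    -- the fraction of time during which the age exceeds `d`, on almost every sample path
    (∀ᵐ ω ∂P, Tendsto
      (fun T : ℝ => volume.real {τ : ℝ | 0 ≤ τ ∧ τ ≤ T ∧ d < MGI11.age Z X τ ω} / T) atTop
      (𝓝 (MGI11.departureRate P Z X k * ∫ ω', MGI11.g Z X d k ω' ∂P))) := by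
  obtain ⟨k, rfl⟩ : ∃ j, k = j + 1 := ⟨k - 1, by omega⟩
  have hrate : 1 / MGI11.departureRate P Z X (k + 1) = 1 / lam + 1 / mu := by
    rw [MGI11.departureRate, one_div_one_div, Nat.add_sub_cancel,
      hsys.integral_TD_sub_TD hlam hXint, hXmean]
  have hfraction := hsys.ae_tendsto_occupationTime_div hlam hXint d k
  exact ⟨hsys.map_idleTime hlam k, hsys.iIndepFun_cycle hlam k, hrate,
    hsys.integrable_g hlam hXint d k,
    fun p hp => hsys.eq_of_tendsto_age_of_ae_tendsto_occupationTime hlam hp hfraction, hfraction⟩
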